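/- For a prime power $q$ let $\mathbb F_q$ be the field with $q$ elements, and let $\mathcal Q$ be the set of prime powers. Let $\mathcal S\subset\mathbb Z[q]$ be the saturated multiplicative system generated by the polynomials $q^n-q$, $n>1$ (that is, all divisors of finite products of such polynomials), and let $\mathsf R=\mathcal S^{-1}\mathbb Z[q]$; elements of $\mathsf R$ are regarded as functions $\mathcal Q\to\mathbb Q$. For a finite simple graph $G$ with vertices $v_1,\dots,v_n$ let $[Z_G]:\mathcal Q\to\mathbb Q$ be the function sending $q$ to the number of nondegenerate symmetric $n\times n$ matrices $M$ over $\mathbb F_q$ such that $M_{ij}=0$ whenever $v_i$ and $v_j$ are joined by an edge. Let $\mathrm{Graphs}_*$ be the $\mathsf R$-submodule of the functions $\mathcal Q\to\mathbb Q$ generated by all $[Z_G]$, $G$ a finite simple graph. Let $G$ be a finite simple graph with vertex set $V$, let $s\ge 0$ be an integer, let $U\subset 2^V$, and let $\pi:U\to\mathbb N$ be any function (a partially defined rank function for $V$). Let $[J_G(s,\pi)]:\mathcal Q\to\mathbb Q$ be the function sending $q$ to the number of pairs $(Q,f)$ where $Q$ is a nondegenerate symmetric bilinear form on $\mathbb F_q^s$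 and $f:V\to\mathbb F_q^s$ is a function such that $Q(f(v),f(w))=0$ whenever $v$ and $w$ are joined by an edge of $G$, and the span of $f(H)$ has dimension $\pi(H)$ for every $H\in U$. Then $[J_G(s,\pi)]\in\mathrm{Graphs}_*$. -/

import Mathlib

noncomputable section

namespace GraphMotives

open Polynomial

/-- The set of prime powers `q = p ^ k`, `k ≥ 1`. -/
abbrev PrimePower : Type := {q : ℕ // IsPrimePow q}

namespace PrimePower

/-- The prime dividing the prime power `q`. -/
def char (q : PrimePower) : ℕ := (q : ℕ).minFac

/-- The exponent `k` in `q = p ^ k`. -/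
def exponent (q : PrimePower) : ℕ := (q : ℕ).factorization (q : ℕ).minFac

instance (q : PrimePower) : Fact q.char.Prime :=
  ⟨Nat.minFac_prime q.2.ne_one⟩

theorem char_pow_exponent (q : PrimePower) : q.char ^ q.exponent = q :=
  q.2.minFac_pow_factorization_eq

/-- The finite field with `q` elements. -/
abbrev Fq (q : PrimePower) : Type := GaloisField q.char q.exponent

theorem exponent_ne_zero (q : PrimePower) : q.exponent ≠ 0 := by
  intro h
  have h1 := q.char_pow_exponent
  rw [h, pow_zero] at h1
  exact q.2.ne_one h1.symm

theorem card_Fq (q : PrimePower) : Nat.card q.Fq = q := by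
  rw [GaloisField.card _ _ q.exponent_ne_zero, char_pow_exponent]

instance (q : PrimePower) : Finite q.Fq :=
  Nat.finite_of_card_ne_zero (by rw [card_Fq]; exact q.2.ne_zero)

end PrimePower

/-- The ring of rational-valued functions on the set of prime powers. -/
abbrev CountFun : Type := PrimePower → ℚ

/-- The saturated multiplicative system in `ℤ[q]` generated by the polynomials `q ^ n - q`,
`n > 1`. -/
def denominators : Submonoid ℤ[X] :=
  (Submonoid.closure {p : ℤ[X] | ∃ n : ℕ, 1 < n ∧ p = X ^ n - X}).saturation.toSubmonoid

/-- A polynomial in `q` as a function on prime powers. -/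
def polyFun : ℤ[X] →+* CountFun :=
  RingHom.pi fun q => Polynomial.eval₂RingHom (Int.castRingHom ℚ) ((q : ℕ) : ℚ)

theorem isUnit_polyFun (m : denominators) : IsUnit (polyFun m) := by
  obtain ⟨m, hm⟩ := m
  obtain ⟨y, hy, hdvd⟩ := Submonoid.mem_saturation_iff_exists_dvd.mp hm
  refine isUnit_of_dvd_unit (map_dvd polyFun hdvd) ?_
  have hle : Submonoid.closure {p : ℤ[X] | ∃ n : ℕ, 1 < n ∧ p = X ^ n - X} ≤
      (IsUnit.submonoid CountFun).comap polyFun := by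
    rw [Submonoid.closure_le]
    rintro _ ⟨n, hn, rfl⟩
    change IsUnit (polyFun (X ^ n - X))
    rw [Pi.isUnit_iff]
    intro q
    have h1 : (1 : ℚ) < ((q : ℕ) : ℚ) := by exact_mod_cast q.2.one_lt
    have h2 : ((q : ℕ) : ℚ) ^ 1 < ((q : ℕ) : ℚ) ^ n := pow_lt_pow_right₀ h1 hn
    have h3 : polyFun (X ^ n - X) q = ((q : ℕ) : ℚ) ^ n - ((q : ℕ) : ℚ) := by
      change Polynomial.eval₂RingHom (Int.castRingHom ℚ) ((q : ℕ) : ℚ) (X ^ n - X) = _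
      simp
    rw [h3, isUnit_iff_ne_zero, sub_ne_zero]
    rw [pow_one] at h2
    exact h2.ne'
  exact hle hy

/-- The localization of `ℤ[q]` at `denominators`. -/
abbrev CoeffRing : Type := Localization denominators

/-- Elements of `CoeffRing` are everywhere-defined functions on prime powers. -/
def coeffFun : CoeffRing →+* CountFun :=
  IsLocalization.lift (M := denominators) (g := polyFun) isUnit_polyFun

/-- `CoeffRing` acts on functions on prime powers by pointwise multiplication. -/
instance : Module CoeffRing CountFun := Module.compHom CountFun coeffFun

section Points

variable (K : Type*) [Field K]

/-- The `K`-points of `Z_G`: nondegenerate symmetric matrices, indexed by the vertices, whose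
entries vanish along the edges of `G`. -/
def ZPoints {V : Type*} [Fintype V] [DecidableEq V] (G : SimpleGraph V) : Set (Matrix V V K) :=
  {M | M.IsSymm ∧ IsUnit M.det ∧ ∀ v w, G.Adj v w → M v w = 0}

/-- The `K`-points of `J_G(s)`: pairs of a nondegenerate symmetric bilinear form `Q` on `K ^ s`
and a function `f : V → K ^ s` with `Q (f v) (f w) = 0` along the edges of `G`. -/
def JPoints {V : Type*} (G : SimpleGraph V) (s : ℕ) :
    Set (LinearMap.BilinForm K (Fin s → K) × (V → Fin s → K)) :=
  {x | x.1.IsSymm ∧ x.1.Nondegenerate ∧ ∀ v w, G.Adj v w → x.1 (x.2 v) (x.2 w) = 0}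

/-- The `K`-points of `J_G(s, π)`, where `π` is a partially defined rank function with domain
`U`: points of `J_G(s)` such that `f` restricted to `H` has rank `π H` for each `H ∈ U`. -/
def JRankPoints {V : Type*} (G : SimpleGraph V) (s : ℕ) {U : Set (Set V)} (π : U → ℕ) :
    Set (LinearMap.BilinForm K (Fin s → K) × (V → Fin s → K)) :=
  {x | x ∈ JPoints K G s ∧
    ∀ H : U, Module.finrank K (Submodule.span K (x.2 '' (H : Set V))) = π H}

end Points

/-- The function `[Z_G] : q ↦ # Z_G(𝔽_q)`. -/
def countZ {V : Type*} [Fintype V] [DecidableEq V] (G : SimpleGraph V) : CountFun :=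
  fun q => (Nat.card (ZPoints q.Fq G) : ℚ)

/-- The function `[J_G(s, π)] : q ↦ # J_G(s, π)(𝔽_q)`. -/
def countJ {V : Type*} (G : SimpleGraph V) (s : ℕ) {U : Set (Set V)} (π : U → ℕ) : CountFun :=
  fun q => (Nat.card (JRankPoints q.Fq G s π) : ℚ)

/-- The module generated over `CoeffRing` by the functions `[Z_G]`, `G` a finite simple graph
(every such graph is isomorphic to one with vertex set `Fin n`). -/
def GraphsStar : Submodule CoeffRing CountFun :=
  Submodule.span CoeffRing {φ | ∃ (n : ℕ) (G : SimpleGraph (Fin n)), φ = countZ G}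

end GraphMotives

end

/-!
Adding an isolated vertex to `G` borders the symmetric matrices vanishing along the edges of `G`,
and the number of borders raising the rank by `0`, `1` or `2` depends only on the rank. In the
resulting relation the count of matrices of the least rank `k` has the coefficient
`q (q ^ n - q ^ k)`, a unit, so induction on the corank puts the number of such matrices of any
given rank in `GraphsStar`, starting from `[Z_G]` in corank `0`.

A point `(Q, f)` of `J_G(s)` with `f` spanning amounts to a Gram matrix of rank `s` together with a
basis of its column space, and isolated vertices again reduce the other spanning dimensions to this
one. Finally, a new vertex joined to all of `H` multiplies the contribution of `(Q, f)` by
`q ^ (s - dim ⟨f(H)⟩)`. The differences of these powers of `q` are units, so Lagrange interpolation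
writes the indicator of `dim ⟨f(H)⟩ = π(H)` as a polynomial in them.
-/

noncomputable section

namespace GraphMotives

open Polynomial Module
open scoped Matrix

section Coefficients

/-- The variable `q` of `ℤ[q]`, as an element of the coefficient ring. -/
def qCoeff : CoeffRing := algebraMap ℤ[X] CoeffRing X

/-- The value of a coefficient at a prime power. -/
def coeffEval (q : PrimePower) : CoeffRing →+* ℚ := (Pi.evalRingHom _ q).comp coeffFun

theorem coeffEval_qCoeff (q : PrimePower) : coeffEval q qCoeff = (q : ℕ) := by
  change coeffFun (algebraMap ℤ[X] CoeffRing X) q = _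
  rw [coeffFun, IsLocalization.lift_eq]
  exact eval₂_X _ _

theorem PrimePower.fintypeCard_Fq (q : PrimePower) [Fintype q.Fq] : Fintype.card q.Fq = q := by
  rw [← Nat.card_eq_fintype_card, q.card_Fq]

theorem coeff_smul_apply (c : CoeffRing) (φ : CountFun) (q : PrimePower) :
    (c • φ) q = coeffEval q c * φ q := rfl

theorem X_pow_sub_X_pow_mem_denominators {m n : ℕ} (h : m < n) :
    (X ^ n - X ^ m : ℤ[X]) ∈ denominators := by
  have hgen (k : ℕ) (hk : 1 < k) : (X ^ k - X : ℤ[X]) ∈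
      Submonoid.closure {p : ℤ[X] | ∃ n : ℕ, 1 < n ∧ p = X ^ n - X} :=
    Submonoid.subset_closure ⟨k, hk, rfl⟩
  obtain ⟨d, rfl⟩ := Nat.exists_eq_add_of_lt h
  refine Submonoid.mem_saturation_iff_exists_dvd.mpr ⟨(X ^ 2 - X) ^ m * (X ^ (d + 2) - X),
    mul_mem (pow_mem (hgen 2 one_lt_two) m) (hgen (d + 2) (by lia)), (X - 1) ^ m * X, ?_⟩
  rw [show (X ^ 2 - X : ℤ[X]) = X * (X - 1) by ring, mul_pow]
  ring

theorem isUnit_qCoeff_pow_sub_pow {m n : ℕ} (h : m ≠ n) : IsUnit (qCoeff ^ n - qCoeff ^ m) := by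
  wlog hlt : m < n generalizing m n
  · rw [← neg_sub]
    exact (this h.symm (by lia)).neg
  simpa [qCoeff] using IsLocalization.map_units CoeffRing
    (⟨_, X_pow_sub_X_pow_mem_denominators hlt⟩ : denominators)

theorem isUnit_qCoeff : IsUnit qCoeff :=
  isUnit_of_dvd_unit ⟨qCoeff - 1, by ring⟩ (isUnit_qCoeff_pow_sub_pow (show 1 ≠ 2 by decide))

end Coefficients

theorem exists_eval_eq_ite {R ι : Type*} [CommRing R] [DecidableEq ι] {s : Finset ι} {x : ι → R}
    (hx : (s : Set ι).Pairwise fun i j => IsUnit (x i - x j)) (i : ι) :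
    ∃ P : R[X], ∀ j ∈ s, P.eval (x j) = if j = i then 1 else 0 := by
  by_cases hi : i ∈ s
  · refine ⟨∏ j ∈ s.erase i, C (Ring.inverse (x i - x j)) * (X - C (x j)), fun k hk => ?_⟩
    simp only [eval_prod, eval_mul, eval_C, eval_sub, eval_X]
    split_ifs with hki
    · subst hki
      refine Finset.prod_eq_one fun j hj => ?_
      obtain ⟨hjk, hj⟩ := Finset.mem_erase.mp hj
      exact Ring.inverse_mul_cancel _ (hx hk hj hjk.symm)
    · exact Finset.prod_eq_zero (Finset.mem_erase.mpr ⟨hki, hk⟩) (by rw [sub_self, mul_zero])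
  · exact ⟨0, fun j hj => by rw [eval_zero, if_neg (ne_of_mem_of_not_mem hj hi)]⟩

section WeightedCount

variable {S : PrimePower → Type*} [∀ q, Finite (S q)] {T : Type*}

/-- For a finite set `S q` and a statistic `w q : S q → T` given for every prime power `q`, the
function `q ↦ ∑ x ∈ S q, g (w q x)(q)`, linear in the weight `g : T → CoeffRing`. Relations between
point counts become identities between weights. -/
def weightedCount (w : ∀ q, S q → T) : (T → CoeffRing) →ₗ[CoeffRing] CountFun where
  toFun g q := ∑ᶠ x, coeffEval q (g (w q x))
  map_add' g h := by
    ext q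
    simp only [Pi.add_apply, map_add]
    exact finsum_add_distrib (Set.toFinite _) (Set.toFinite _)
  map_smul' c g := by
    ext q
    simp only [Pi.smul_apply, smul_eq_mul, map_mul, RingHom.id_apply, coeff_smul_apply]
    exact (mul_finsum _ _).symm

theorem weightedCount_apply (w : ∀ q, S q → T) (g : T → CoeffRing) (q : PrimePower)
    [Fintype (S q)] : weightedCount w g q = ∑ x, coeffEval q (g (w q x)) :=
  finsum_eq_sum_of_fintype _

theorem weightedCount_congr {w : ∀ q, S q → T} {g h : T → CoeffRing}
    (hgh : ∀ q x, g (w q x) = h (w q x)) : weightedCount w g = weightedCount w h :=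
  funext fun q => finsum_congr fun x => congrArg (coeffEval q) (hgh q x)

theorem weightedCount_ite (w : ∀ q, S q → T) (P : T → Prop) [DecidablePred P] :
    weightedCount w (fun t => if P t then 1 else 0) =
      fun q => (Nat.card {x // P (w q x)} : ℚ) := by
  ext q
  have := Fintype.ofFinite (S q)
  simp [weightedCount_apply, Fintype.card_subtype, apply_ite (coeffEval q)]

theorem weightedCount_single [DecidableEq T] (w : ∀ q, S q → T) (t : T) :
    weightedCount w (Pi.single t 1) = fun q => (Nat.card {x // w q x = t} : ℚ) := by
  simp only [← weightedCount_ite w (· = t), ← Pi.single_apply]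

end WeightedCount

section Span

variable {K E : Type*} [Field K] [AddCommGroup E] [Module K E]

open scoped Classical in
theorem finrank_span_insert [FiniteDimensional K E] (S : Set E) (x : E) :
    finrank K (Submodule.span K (insert x S)) =
      finrank K (Submodule.span K S) + if x ∈ Submodule.span K S then 0 else 1 := by
  split_ifs with h
  · rw [Submodule.span_insert_eq_span h, add_zero]
  · have hx : x ≠ 0 := fun h0 => h (h0 ▸ zero_mem _)
    have hinf : Submodule.span K {x} ⊓ Submodule.span K S = ⊥ :=
      ((Submodule.disjoint_span_singleton' hx).mpr h).symm.eq_bot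
    have hsup := Submodule.finrank_sup_add_finrank_inf_eq (Submodule.span K {x})
      (Submodule.span K S)
    rwa [← Submodule.span_insert, hinf, finrank_bot, finrank_span_singleton hx, add_comm 1] at hsup

theorem card_linearIndependent_mem [Finite K] [FiniteDimensional K E] (W : Submodule K E) {k : ℕ}
    (hk : k ≤ finrank K W) :
    Nat.card {v : Fin k → E // LinearIndependent K v ∧ ∀ i, v i ∈ W} =
      ∏ i : Fin k, (Nat.card K ^ finrank K W - Nat.card K ^ (i : ℕ)) := by
  have := Fintype.ofFinite K
  have := Module.finite_of_finite K (M := W)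
  let restrict : {v : Fin k → E // LinearIndependent K v ∧ ∀ i, v i ∈ W} ≃
      {v : Fin k → W // LinearIndependent K v} :=
    { toFun := fun v => ⟨fun i => ⟨v.1 i, v.2.2 i⟩, .of_comp W.subtype v.2.1⟩
      invFun := fun v => ⟨fun i => v.1 i, v.2.map' W.subtype W.ker_subtype, fun i => (v.1 i).2⟩
      left_inv := fun _ => rfl
      right_inv := fun _ => rfl }
  rw [Nat.card_congr restrict, card_linearIndependent hk, Nat.card_eq_fintype_card]

variable {A : Type*} [CommRing A] [Fintype K] [Fintype E]

theorem sum_ite_mem_submodule (W : Submodule K E) [DecidablePred (· ∈ W)] (a b : A) :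
    ∑ y, (if y ∈ W then a else b) = (Fintype.card K : A) ^ finrank K W * a +
      ((Fintype.card K : A) ^ finrank K E - (Fintype.card K : A) ^ finrank K W) * b := by
  have hW : Finset.card {y | y ∈ W} = Fintype.card K ^ finrank K W := by
    rw [← Fintype.card_subtype]
    exact card_eq_pow_finrank
  calc ∑ y, (if y ∈ W then a else b)
      = ∑ y, ((if y ∈ W then a - b else 0) + b) :=
        Finset.sum_congr rfl fun y _ => by split_ifs <;> ring
    _ = Finset.card {y | y ∈ W} * (a - b) + Fintype.card E * b := by
        simp [Finset.sum_add_distrib, ← Finset.sum_filter, mul_sub]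
    _ = _ := by
        rw [hW, card_eq_pow_finrank (K := K) (V := E)]
        push_cast
        ring

theorem sum_finrank_span_insert (S : Set E) (g : ℕ → A) :
    ∑ y, g (finrank K (Submodule.span K (insert y S))) =
      (Fintype.card K : A) ^ finrank K (Submodule.span K S) * g (finrank K (Submodule.span K S)) +
      ((Fintype.card K : A) ^ finrank K E - (Fintype.card K : A) ^ finrank K (Submodule.span K S)) *
        g (finrank K (Submodule.span K S) + 1) := by
  classical
  simp only [finrank_span_insert, apply_ite (finrank K (Submodule.span K S) + ·), apply_ite g,
    add_zero, sum_ite_mem_submodule]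

end Span

section Border

variable {K V : Type*} [Field K]

/-- The matrix `M` bordered by the vector `b`, both as last column and as last row, and by the
corner entry `c`. -/
def border (M : Matrix V V K) (b : V → K) (c : K) : Matrix (V ⊕ Unit) (V ⊕ Unit) K :=
  .fromBlocks M (.replicateCol Unit b) (.replicateRow Unit b) (.of fun _ _ => c)

open scoped Classical in
theorem rank_fromCols_replicateCol {m n : Type*} [Finite m] [Fintype n] (M : Matrix m n K)
    (b : m → K) :
    (Matrix.fromCols M (.replicateCol Unit b)).rank =
      M.rank + if b ∈ LinearMap.range M.mulVecLin then 0 else 1 := by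
  have hcols : Set.range (Matrix.fromCols M (.replicateCol Unit b)).col =
      insert b (Set.range M.col) := by
    have hcol : (Matrix.fromCols M (.replicateCol Unit b)).col = Sum.elim M.col fun _ => b := by
      ext (_ | _) <;> rfl
    rw [hcol, Set.Sum.elim_range, Set.range_const, Set.union_singleton]
  rw [Matrix.rank_eq_finrank_span_cols, hcols, finrank_span_insert, Matrix.range_mulVecLin,
    Matrix.rank_eq_finrank_span_cols]

open scoped Classical in
theorem rank_fromRows_replicateRow {m n : Type*} [Fintype m] [Fintype n] (M : Matrix m n K)
    (b : n → K) :
    (Matrix.fromRows M (.replicateRow Unit b)).rank =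
      M.rank + if b ∈ LinearMap.range M.vecMulLinear then 0 else 1 := by
  rw [← Matrix.rank_transpose, Matrix.transpose_fromRows, Matrix.transpose_replicateRow,
    rank_fromCols_replicateCol, Matrix.rank_transpose, Matrix.mulVecLin_transpose]

variable [Fintype V] {M : Matrix V V K}

theorem rank_eq_card_iff_isUnit_det [DecidableEq V] :
    M.rank = Fintype.card V ↔ IsUnit M.det := by
  rw [← Matrix.isUnit_iff_isUnit_det, ← Matrix.linearIndependent_cols_iff_isUnit,
    linearIndependent_iff_card_eq_finrank_span, Matrix.rank_eq_finrank_span_cols, eq_comm]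
  rfl

open scoped Classical in
theorem rank_border (M : Matrix V V K) (b : V → K) (c : K) :
    (border M b c).rank = M.rank + (if b ∈ LinearMap.range M.mulVecLin then 0 else 1) +
      if ∃ y, y ᵥ* M = b ∧ y ⬝ᵥ b = c then 0 else 1 := by
  have hrow : (Sum.elim b fun _ => c) ∈ LinearMap.range
      (Matrix.fromCols M (.replicateCol Unit b)).vecMulLinear ↔ ∃ y, y ᵥ* M = b ∧ y ⬝ᵥ b = c := by
    refine exists_congr fun y => ?_
    rw [Matrix.vecMulLinear_apply, Matrix.vecMul_fromCols, Sum.elim_eq_iff]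
    exact and_congr_right fun _ => ⟨fun h => congrFun h (), fun h => funext fun _ => h⟩
  rw [← rank_fromCols_replicateCol, ← if_congr hrow rfl rfl, ← rank_fromRows_replicateRow, border,
    ← Matrix.fromRows_fromCols_eq_fromBlocks]
  congr 2

theorem rank_border_of_notMem_range (hM : M.IsSymm) {b : V → K}
    (hb : b ∉ LinearMap.range M.mulVecLin) (c : K) : (border M b c).rank = M.rank + 2 := by
  classical
  rw [rank_border, if_neg hb, if_neg]
  rintro ⟨y, hy, -⟩
  exact hb ⟨y, by rw [Matrix.mulVecLin_apply, ← Matrix.vecMul_transpose, hM.eq, hy]⟩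

theorem rank_border_mulVec [DecidableEq K] (hM : M.IsSymm) (x : V → K) (c : K) :
    (border M (M *ᵥ x) c).rank = M.rank + if c = x ⬝ᵥ M *ᵥ x then 0 else 1 := by
  classical
  have hcorner : (∃ y, y ᵥ* M = M *ᵥ x ∧ y ⬝ᵥ M *ᵥ x = c) ↔ c = x ⬝ᵥ M *ᵥ x := by
    constructor
    · rintro ⟨y, hy, rfl⟩
      rw [Matrix.dotProduct_mulVec, hy, dotProduct_comm]
    · rintro rfl
      exact ⟨x, by rw [← Matrix.mulVec_transpose, hM.eq], rfl⟩
  rw [rank_border, if_pos ⟨x, rfl⟩, add_zero, if_congr hcorner rfl rfl]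

theorem sum_rank_border {A : Type*} [CommRing A] [Fintype K] [DecidableEq V] (hM : M.IsSymm)
    (g : ℕ → A) :
    ∑ p : (V → K) × K, g (border M p.1 p.2).rank =
      (Fintype.card K : A) ^ M.rank * (g M.rank + (Fintype.card K - 1) * g (M.rank + 1)) +
      ((Fintype.card K : A) ^ Fintype.card V - (Fintype.card K : A) ^ M.rank) *
        (Fintype.card K * g (M.rank + 2)) := by
  classical
  have hcorner (b : V → K) : ∑ c, g (border M b c).rank =
      if b ∈ LinearMap.range M.mulVecLin then g M.rank + (Fintype.card K - 1) * g (M.rank + 1)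
      else Fintype.card K * g (M.rank + 2) := by
    split_ifs with hb
    · obtain ⟨x, rfl⟩ := hb
      rw [Fintype.sum_eq_add_sum_compl (x ⬝ᵥ M *ᵥ x), Matrix.mulVecLin_apply, rank_border_mulVec hM,
        if_pos rfl, add_zero, Finset.sum_congr rfl fun c hc => by
          rw [rank_border_mulVec hM, if_neg (by simpa using hc)]]
      simp [Finset.card_compl, Nat.cast_pred Fintype.card_pos]
    · simp [rank_border_of_notMem_range hM hb]
  rw [Fintype.sum_prod_type, Finset.sum_congr rfl fun b _ => hcorner b, sum_ite_mem_submodule,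
    finrank_fintype_fun_eq_card]
  rfl

end Border

section SymmetricMatrices

variable {V : Type*}

/-- The symmetric matrices vanishing along the edges of `G`, of any rank. -/
def symPoints (K : Type*) [Field K] (G : SimpleGraph V) : Set (Matrix V V K) :=
  {M | M.IsSymm ∧ ∀ v w, G.Adj v w → M v w = 0}

/-- The symmetric matrices for `G` with an isolated vertex added are the bordered symmetric matrices
for `G`, without condition on the border. -/
def borderEquiv (K : Type*) [Field K] (G : SimpleGraph V) :
    symPoints K G × ((V → K) × K) ≃ symPoints K (G ⊕g (⊥ : SimpleGraph Unit)) where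
  toFun x := ⟨border x.1 x.2.1 x.2.2, by
    refine ⟨Matrix.isSymm_fromBlocks_iff.mpr ⟨x.1.2.1, rfl, rfl, rfl⟩, ?_⟩
    rintro (v | _) (w | _) h
    exacts [x.1.2.2 v w (SimpleGraph.sum_adj_inl.mp h), by simp at h, by simp at h, by simp at h]⟩
  invFun N := (⟨N.1.toBlocks₁₁, N.2.1.submatrix _, fun v w h =>
      N.2.2 _ _ (SimpleGraph.sum_adj_inl.mpr h)⟩,
    fun v => N.1 (.inl v) (.inr ()), N.1 (.inr ()) (.inr ()))
  left_inv _ := rfl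
  right_inv N := by
    ext (v | _) (w | _)
    exacts [rfl, rfl, N.2.1.apply _ _, rfl]

variable [Fintype V]

/-- The sums `∑ g (rank M)` over the symmetric matrices `M` vanishing along the edges of `G`. -/
def symRankSum (G : SimpleGraph V) : (ℕ → CoeffRing) →ₗ[CoeffRing] CountFun :=
  weightedCount (S := fun q => symPoints q.Fq G) fun _ M => M.1.rank

theorem symRankSum_addIsolated (G : SimpleGraph V) (g : ℕ → CoeffRing) :
    symRankSum (G ⊕g (⊥ : SimpleGraph Unit)) g = symRankSum G fun r =>
      qCoeff ^ r * (g r + (qCoeff - 1) * g (r + 1)) +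
        (qCoeff ^ Fintype.card V - qCoeff ^ r) * (qCoeff * g (r + 2)) := by
  classical
  ext q
  have := Fintype.ofFinite q.Fq
  have := Fintype.ofFinite (symPoints q.Fq G)
  have := Fintype.ofFinite (symPoints q.Fq (G ⊕g (⊥ : SimpleGraph Unit)))
  rw [symRankSum, symRankSum, weightedCount_apply, weightedCount_apply,
    ← (borderEquiv q.Fq G).sum_comp, Fintype.sum_prod_type]
  refine Finset.sum_congr rfl fun M _ => ?_
  simp only [map_add, map_mul, map_sub, map_pow, map_one, coeffEval_qCoeff, ← q.fintypeCard_Fq]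
  exact sum_rank_border M.2.1 fun r => coeffEval q (g r)

theorem symRankSum_single_addIsolated (G : SimpleGraph V) (k : ℕ) :
    symRankSum (G ⊕g (⊥ : SimpleGraph Unit)) (Pi.single (k + 2) 1) =
      qCoeff ^ (k + 2) • symRankSum G (Pi.single (k + 2) 1) +
      (qCoeff ^ (k + 1) * (qCoeff - 1)) • symRankSum G (Pi.single (k + 1) 1) +
      ((qCoeff ^ Fintype.card V - qCoeff ^ k) * qCoeff) • symRankSum G (Pi.single k 1) := by
  rw [symRankSum_addIsolated]
  simp only [← map_smul, ← map_add]
  congr 1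
  ext r
  simp only [Pi.add_apply, Pi.smul_apply, Pi.single_apply, smul_eq_mul, Nat.add_right_cancel_iff]
  split_ifs <;> grind

theorem countZ_mem_GraphsStar [DecidableEq V] (G : SimpleGraph V) : countZ G ∈ GraphsStar := by
  let e := Fintype.equivFin V
  refine Submodule.subset_span ⟨_, G.comap e.symm, funext fun q => ?_⟩
  refine congrArg Nat.cast (Nat.card_congr ((Matrix.reindex e e).subtypeEquiv fun M => ?_))
  refine and_congr ?_ (and_congr ?_ ?_)
  · simp [Matrix.IsSymm.ext_iff, e.symm.surjective.forall]
  · rw [Matrix.det_reindex_self]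
  · simp [e.symm.surjective.forall]

theorem symRankSum_single_card [DecidableEq V] (G : SimpleGraph V) :
    symRankSum G (Pi.single (Fintype.card V) 1) = countZ G := by
  rw [symRankSum, weightedCount_single]
  refine funext fun q => congrArg Nat.cast (Nat.card_congr ?_)
  refine (Equiv.subtypeSubtypeEquivSubtypeInter (· ∈ symPoints q.Fq G) fun M =>
    M.rank = Fintype.card V).trans (Equiv.subtypeEquivRight fun M => ?_)
  simp only [symPoints, ZPoints, Set.mem_ofPred_eq, rank_eq_card_iff_isUnit_det]
  tauto

theorem symRankSum_single_of_card_lt (G : SimpleGraph V) {k : ℕ} (hk : Fintype.card V < k) :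
    symRankSum G (Pi.single k 1) = 0 := by
  rw [← map_zero (symRankSum G)]
  exact weightedCount_congr fun q M => Pi.single_eq_of_ne (M.1.rank_le_card_width.trans_lt hk).ne 1

theorem symRankSum_single_mem_GraphsStar (G : SimpleGraph V) (k : ℕ) :
    symRankSum G (Pi.single k 1) ∈ GraphsStar := by
  classical
  induction hd : Fintype.card V - k using Nat.strong_induction_on generalizing V k with
  | _ d ih =>
    subst hd
    rcases lt_trichotomy k (Fintype.card V) with hk | rfl | hk
    · have hunit : IsUnit ((qCoeff ^ Fintype.card V - qCoeff ^ k) * qCoeff) :=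
        (isUnit_qCoeff_pow_sub_pow hk.ne).mul isUnit_qCoeff
      rw [← Submodule.smul_mem_iff_of_isUnit _ hunit,
        eq_sub_of_add_eq' (symRankSum_single_addIsolated G k).symm]
      refine sub_mem (ih _ ?_ _ _ rfl) (add_mem (Submodule.smul_mem _ _ (ih _ ?_ _ _ rfl))
        (Submodule.smul_mem _ _ (ih _ ?_ _ _ rfl)))
      · rw [Fintype.card_sum, Fintype.card_unit]
        lia
      all_goals lia
    · rw [symRankSum_single_card]
      exact countZ_mem_GraphsStar G
    · rw [symRankSum_single_of_card_lt G hk]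
      exact zero_mem _

end SymmetricMatrices

section Congruence

variable {K m n : Type*} [Field K]

theorem exists_mul_eq_one_of_linearIndependent_col [Fintype m] [Finite n] [DecidableEq n]
    {F : Matrix m n K} (hF : LinearIndependent K F.col) :
    ∃ L : Matrix n m K, L * F = 1 := by
  classical
  have := Fintype.ofFinite n
  obtain ⟨g, hg⟩ := F.mulVecLin.exists_leftInverse_of_injective
    (LinearMap.ker_eq_bot.mpr (Matrix.mulVec_injective_iff.mpr hF))
  refine ⟨LinearMap.toMatrix' g, Matrix.toLin'.injective ?_⟩
  rw [Matrix.toLin'_mul, Matrix.toLin'_toMatrix', Matrix.toLin'_one]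
  exact hg

variable [Fintype n]

theorem range_mulVecLin_mul_le {o : Type*} [Fintype o] (A : Matrix m n K) (B : Matrix n o K) :
    LinearMap.range (A * B).mulVecLin ≤ LinearMap.range A.mulVecLin := by
  rw [Matrix.mulVecLin_mul]
  exact LinearMap.range_comp_le_range _ _

theorem isSymm_congruence {A : Matrix n n K} (hA : A.IsSymm) (F : Matrix m n K) :
    (F * A * Fᵀ).IsSymm := by
  simp only [Matrix.IsSymm, Matrix.transpose_mul, Matrix.transpose_transpose, hA.eq,
    Matrix.mul_assoc]

variable [Fintype m] [DecidableEq n] {F : Matrix m n K} {L : Matrix n m K}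

theorem mul_congruence_mul (hL : L * F = 1) (A : Matrix n n K) : L * (F * A * Fᵀ) * Lᵀ = A := by
  have hLt : Fᵀ * Lᵀ = 1 := by rw [← Matrix.transpose_mul, hL, Matrix.transpose_one]
  calc L * (F * A * Fᵀ) * Lᵀ = L * F * A * (Fᵀ * Lᵀ) := by simp only [Matrix.mul_assoc]
    _ = A := by rw [hL, hLt, Matrix.one_mul, Matrix.mul_one]

theorem range_mulVecLin_congruence (hL : L * F = 1) {A : Matrix n n K} (hA : IsUnit A.det) :
    LinearMap.range (F * A * Fᵀ).mulVecLin = LinearMap.range F.mulVecLin := by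
  have hLt : Fᵀ * Lᵀ = 1 := by rw [← Matrix.transpose_mul, hL, Matrix.transpose_one]
  have hF : F = F * A * Fᵀ * (Lᵀ * A⁻¹) := by
    rw [Matrix.mul_assoc (F * A), ← Matrix.mul_assoc Fᵀ, hLt, Matrix.one_mul,
      A.mul_nonsing_inv_cancel_right F hA]
  refine le_antisymm ?_ ?_
  · rw [Matrix.mul_assoc]
    exact range_mulVecLin_mul_le _ _
  · conv_lhs => rw [hF]
    exact range_mulVecLin_mul_le _ _

theorem congruence_mul_congruence (hL : L * F = 1) {M : Matrix m m K} (hM : M.IsSymm)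
    (hMF : LinearMap.range M.mulVecLin ≤ LinearMap.range F.mulVecLin) :
    F * (L * M * Lᵀ) * Fᵀ = M := by
  classical
  have hproj : F * L * M = M := by
    refine Matrix.ext_of_mulVec_single fun i => ?_
    obtain ⟨y, hy⟩ := hMF ⟨Pi.single i 1, rfl⟩
    rw [Matrix.mulVecLin_apply, Matrix.mulVecLin_apply] at hy
    rw [← Matrix.mulVec_mulVec, ← hy, Matrix.mulVec_mulVec, Matrix.mul_assoc, hL, Matrix.mul_one]
  have hprojT : M * (Lᵀ * Fᵀ) = M := by
    simpa [Matrix.mul_assoc, hM.eq] using congrArg Matrix.transpose hproj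
  calc F * (L * M * Lᵀ) * Fᵀ = F * L * M * (Lᵀ * Fᵀ) := by simp only [Matrix.mul_assoc]
    _ = M := by rw [hproj, hprojT]

theorem exists_eq_congruence {M : Matrix m m K} (hM : M.IsSymm) (hrank : M.rank = Fintype.card n)
    (hF : LinearIndependent K F.col) (hFM : ∀ j, F.col j ∈ LinearMap.range M.mulVecLin) :
    ∃ A : Matrix n n K, (A.IsSymm ∧ IsUnit A.det) ∧ F * A * Fᵀ = M := by
  classical
  obtain ⟨L, hL⟩ := exists_mul_eq_one_of_linearIndependent_col hF
  have hrange : LinearMap.range F.mulVecLin = LinearMap.range M.mulVecLin := by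
    rw [Matrix.range_mulVecLin F]
    refine Submodule.eq_of_le_of_finrank_eq (Submodule.span_le.mpr ?_) ?_
    · rintro _ ⟨j, rfl⟩
      exact hFM j
    · rw [finrank_span_eq_card hF, ← hrank, Matrix.rank]
  have hcongr := congruence_mul_congruence hL hM hrange.ge
  refine ⟨L * M * Lᵀ, ⟨isSymm_congruence hM L, ?_⟩, hcongr⟩
  rw [← rank_eq_card_iff_isUnit_det]
  refine (Matrix.rank_le_card_width _).antisymm ?_
  conv_lhs => rw [← hrank, ← hcongr]
  exact (Matrix.rank_mul_le_left _ _).trans (Matrix.rank_mul_le_right _ _)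

theorem bijOn_congruence :
    Set.BijOn (fun x : Matrix n n K × Matrix m n K => (x.2 * x.1 * x.2ᵀ, x.2))
      {x | (x.1.IsSymm ∧ IsUnit x.1.det) ∧ LinearIndependent K x.2.col}
      {y | (y.1.IsSymm ∧ y.1.rank = Fintype.card n) ∧
        LinearIndependent K y.2.col ∧ ∀ j, y.2.col j ∈ LinearMap.range y.1.mulVecLin} := by
  refine ⟨?_, ?_, ?_⟩
  · rintro ⟨A, F⟩ ⟨⟨hA, hdet⟩, hF⟩
    obtain ⟨L, hL⟩ := exists_mul_eq_one_of_linearIndependent_col hF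
    have hrange := range_mulVecLin_congruence hL hdet
    refine ⟨⟨isSymm_congruence hA F, ?_⟩, hF, fun j => ?_⟩
    · rw [Matrix.rank, hrange, ← Matrix.rank, Matrix.rank_eq_finrank_span_cols,
        finrank_span_eq_card hF]
    · simp only [hrange]
      exact ⟨Pi.single j 1, F.mulVec_single_one j⟩
  · rintro ⟨A, F⟩ ⟨-, hF⟩ ⟨A', F'⟩ - h
    obtain ⟨hA, rfl⟩ : F * A * Fᵀ = F' * A' * F'ᵀ ∧ F = F' := Prod.ext_iff.mp h
    obtain ⟨L, hL⟩ := exists_mul_eq_one_of_linearIndependent_col hF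
    rw [← mul_congruence_mul hL A, hA, mul_congruence_mul hL]
  · rintro ⟨M, F⟩ ⟨⟨hM, hrank⟩, hF, hFM⟩
    obtain ⟨A, hA, hAM⟩ := exists_eq_congruence hM hrank hF hFM
    exact ⟨(A, F), ⟨hA, hF⟩, Prod.ext hAM rfl⟩

end Congruence

section SpanningPoints

variable {V K : Type*} [Field K]

instance finite_bilinForm {E : Type*} [AddCommGroup E] [Module K E] [FiniteDimensional K E]
    [Finite K] : Finite (LinearMap.BilinForm K E) :=
  Module.finite_of_finite K

theorem isUnit_det_toMatrix'_iff {n : Type*} [Fintype n] [DecidableEq n]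
    {Q : LinearMap.BilinForm K (n → K)} :
    IsUnit (LinearMap.BilinForm.toMatrix' Q).det ↔ Q.Nondegenerate := by
  rw [← LinearMap.BilinForm.nondegenerate_toMatrix'_iff, Matrix.nondegenerate_iff_det_ne_zero,
    isUnit_iff_ne_zero]

theorem apply_eq_congruence_toMatrix' {n : Type*} [Fintype n] [DecidableEq n]
    (Q : LinearMap.BilinForm K (n → K)) (f : V → n → K) (v w : V) :
    Q (f v) (f w) = (Matrix.of f * LinearMap.BilinForm.toMatrix' Q * (Matrix.of f)ᵀ) v w := by
  conv_lhs => rw [← Matrix.toBilin'_toMatrix' Q, Matrix.toBilin'_apply']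
  rw [Matrix.mul_assoc]
  rfl

theorem finrank_span_range_eq_iff_linearIndependent_col [Finite V] {n : Type*} [Fintype n]
    (f : V → n → K) :
    finrank K (Submodule.span K (Set.range f)) = Fintype.card n ↔
      LinearIndependent K (Matrix.of f).col := by
  have := Fintype.ofFinite V
  rw [linearIndependent_iff_card_eq_finrank_span, eq_comm, Set.finrank,
    ← Matrix.rank_eq_finrank_span_cols, Matrix.rank_eq_finrank_span_row]
  rfl

theorem mem_JPoints_and_finrank_eq_iff [Finite V] {G : SimpleGraph V} {s : ℕ}
    (x : LinearMap.BilinForm K (Fin s → K) × (V → Fin s → K)) :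
    (x ∈ JPoints K G s ∧ finrank K (Submodule.span K (Set.range x.2)) = s) ↔
      (((LinearMap.BilinForm.toMatrix' x.1).IsSymm ∧
        IsUnit (LinearMap.BilinForm.toMatrix' x.1).det) ∧ LinearIndependent K (Matrix.of x.2).col) ∧
      ∀ v w, G.Adj v w →
        (Matrix.of x.2 * LinearMap.BilinForm.toMatrix' x.1 * (Matrix.of x.2)ᵀ) v w = 0 := by
  have hspan := finrank_span_range_eq_iff_linearIndependent_col x.2
  rw [Fintype.card_fin] at hspan
  simp only [JPoints, apply_eq_congruence_toMatrix', Set.mem_ofPred_eq, hspan,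
    ← isUnit_det_toMatrix'_iff, ← LinearMap.BilinForm.isSymm_toMatrix'_iff_isSymm]
  tauto

variable [Fintype V]

/-- A point `(Q, f)` of `J_G(s)` with `f` spanning is given by its Gram matrix `M`, of rank `s`, and
by the coordinates of `f`, which form a basis of the column space of `M`. -/
def spanningPointsEquiv (G : SimpleGraph V) (s : ℕ) :
    {x : JPoints K G s // finrank K (Submodule.span K (Set.range x.1.2)) = s} ≃
      Σ M : {M : symPoints K G // M.1.rank = s}, {v : Fin s → V → K //
        LinearIndependent K v ∧ ∀ j, v j ∈ LinearMap.range M.1.1.mulVecLin} :=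
  have hbij := Fintype.card_fin s ▸ bijOn_congruence (K := K) (m := V) (n := Fin s)
  calc {x : JPoints K G s // finrank K (Submodule.span K (Set.range x.1.2)) = s}
    _ ≃ {x // x ∈ JPoints K G s ∧ finrank K (Submodule.span K (Set.range x.2)) = s} :=
      Equiv.subtypeSubtypeEquivSubtypeInter (· ∈ JPoints K G s) fun x =>
        finrank K (Submodule.span K (Set.range x.2)) = s
    _ ≃ {x : Matrix (Fin s) (Fin s) K × Matrix V (Fin s) K //
          ((x.1.IsSymm ∧ IsUnit x.1.det) ∧ LinearIndependent K x.2.col) ∧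
            ∀ v w, G.Adj v w → (x.2 * x.1 * x.2ᵀ) v w = 0} :=
      (LinearMap.BilinForm.toMatrix'.toEquiv.prodCongr Matrix.of).subtypeEquiv
        mem_JPoints_and_finrank_eq_iff
    _ ≃ {x : {x : Matrix (Fin s) (Fin s) K × Matrix V (Fin s) K //
          (x.1.IsSymm ∧ IsUnit x.1.det) ∧ LinearIndependent K x.2.col} //
            ∀ v w, G.Adj v w → (x.1.2 * x.1.1 * x.1.2ᵀ) v w = 0} :=
      (Equiv.subtypeSubtypeEquivSubtypeInter _ _).symm
    _ ≃ {y : {y : Matrix V V K × Matrix V (Fin s) K // (y.1.IsSymm ∧ y.1.rank = s) ∧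
          LinearIndependent K y.2.col ∧ ∀ j, y.2.col j ∈ LinearMap.range y.1.mulVecLin} //
            ∀ v w, G.Adj v w → y.1.1 v w = 0} :=
      (hbij.equiv _).subtypeEquiv fun _ => Iff.rfl
    _ ≃ _ :=
      { toFun y := ⟨⟨⟨y.1.1.1, y.1.2.1.1, y.2⟩, y.1.2.1.2⟩, y.1.1.2.col, y.1.2.2⟩
        invFun z := ⟨⟨(z.1.1.1, (Matrix.of z.2.1)ᵀ), ⟨z.1.1.2.1, z.1.2⟩, z.2.2⟩, z.1.1.2.2⟩
        left_inv _ := rfl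
        right_inv _ := rfl }

theorem card_spanningPoints [Finite K] (G : SimpleGraph V) (s : ℕ) :
    Nat.card {x : JPoints K G s // finrank K (Submodule.span K (Set.range x.1.2)) = s} =
      (∏ i : Fin s, (Nat.card K ^ s - Nat.card K ^ (i : ℕ))) *
        Nat.card {M : symPoints K G // M.1.rank = s} := by
  have := Fintype.ofFinite {M : symPoints K G // M.1.rank = s}
  have hfibre (M : {M : symPoints K G // M.1.rank = s}) :
      Nat.card {v : Fin s → V → K //
        LinearIndependent K v ∧ ∀ j, v j ∈ LinearMap.range M.1.1.mulVecLin} =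
        ∏ i : Fin s, (Nat.card K ^ s - Nat.card K ^ (i : ℕ)) := by
    have hfinrank : finrank K (LinearMap.range M.1.1.mulVecLin) = s := M.2
    rw [card_linearIndependent_mem _ hfinrank.ge, hfinrank]
  rw [Nat.card_congr (spanningPointsEquiv G s), Nat.card_sigma,
    Finset.sum_congr rfl fun M _ => hfibre M, Finset.sum_const, Finset.card_univ, smul_eq_mul,
    mul_comm, Nat.card_eq_fintype_card (α := {M : symPoints K G // M.1.rank = s})]

end SpanningPoints

section SpanDimension

variable {V : Type*}

/-- An isolated vertex can be sent to any vector. -/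
def sumElimEquiv (K : Type*) [Field K] (G : SimpleGraph V) (s : ℕ) :
    JPoints K G s × (Fin s → K) ≃ JPoints K (G ⊕g (⊥ : SimpleGraph Unit)) s where
  toFun x := ⟨(x.1.1.1, Sum.elim x.1.1.2 fun _ => x.2), by
    refine ⟨x.1.2.1, x.1.2.2.1, ?_⟩
    rintro (v | _) (w | _) h
    exacts [x.1.2.2.2 v w (SimpleGraph.sum_adj_inl.mp h), by simp at h, by simp at h, by simp at h]⟩
  invFun x := (⟨(x.1.1, x.1.2 ∘ Sum.inl), x.2.1, x.2.2.1, fun v w h =>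
    x.2.2.2 _ _ (SimpleGraph.sum_adj_inl.mpr h)⟩, x.1.2 (.inr ()))
  left_inv _ := rfl
  right_inv x := Subtype.ext <| Prod.ext rfl <| Sum.elim_comp_inl_inr x.1.2

variable [Finite V]

/-- The sums `∑ g (dim ⟨f(V)⟩)` over the points `(Q, f)` of `J_G(s)`. -/
def spanDimSum (G : SimpleGraph V) (s : ℕ) : (ℕ → CoeffRing) →ₗ[CoeffRing] CountFun :=
  weightedCount (S := fun q => JPoints q.Fq G s) fun q x =>
    finrank q.Fq (Submodule.span q.Fq (Set.range x.1.2))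

theorem spanDimSum_addIsolated (G : SimpleGraph V) (s : ℕ) (g : ℕ → CoeffRing) :
    spanDimSum (G ⊕g (⊥ : SimpleGraph Unit)) s g = spanDimSum G s fun d =>
      qCoeff ^ d * g d + (qCoeff ^ s - qCoeff ^ d) * g (d + 1) := by
  classical
  ext q
  have := Fintype.ofFinite q.Fq
  have := Fintype.ofFinite (JPoints q.Fq G s)
  have := Fintype.ofFinite (JPoints q.Fq (G ⊕g (⊥ : SimpleGraph Unit)) s)
  rw [spanDimSum, spanDimSum, weightedCount_apply, weightedCount_apply,
    ← (sumElimEquiv q.Fq G s).sum_comp, Fintype.sum_prod_type]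
  refine Finset.sum_congr rfl fun x _ => ?_
  have hspan (y : Fin s → q.Fq) :
      finrank q.Fq (Submodule.span q.Fq (Set.range (sumElimEquiv q.Fq G s (x, y)).1.2)) =
        finrank q.Fq (Submodule.span q.Fq (insert y (Set.range x.1.2))) := by
    rw [← Set.union_singleton, ← Set.range_const (ι := Unit), ← Set.Sum.elim_range]
    rfl
  simp only [hspan, map_add, map_mul, map_sub, map_pow, coeffEval_qCoeff, ← q.fintypeCard_Fq]
  simpa only [finrank_fin_fun] using
    sum_finrank_span_insert (K := q.Fq) (Set.range x.1.2) fun d => coeffEval q (g d)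

theorem spanDimSum_single_addIsolated (G : SimpleGraph V) (s r : ℕ) :
    spanDimSum (G ⊕g (⊥ : SimpleGraph Unit)) s (Pi.single (r + 1) 1) =
      qCoeff ^ (r + 1) • spanDimSum G s (Pi.single (r + 1) 1) +
        (qCoeff ^ s - qCoeff ^ r) • spanDimSum G s (Pi.single r 1) := by
  rw [spanDimSum_addIsolated]
  simp only [← map_smul, ← map_add]
  congr 1
  ext d
  simp only [Pi.add_apply, Pi.smul_apply, Pi.single_apply, smul_eq_mul, Nat.add_right_cancel_iff]
  split_ifs <;> grind

theorem spanDimSum_single_self [Fintype V] (G : SimpleGraph V) (s : ℕ) :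
    spanDimSum G s (Pi.single s 1) =
      (∏ i : Fin s, (qCoeff ^ s - qCoeff ^ (i : ℕ))) • symRankSum G (Pi.single s 1) := by
  rw [spanDimSum, symRankSum, weightedCount_single, weightedCount_single]
  ext q
  have hpow (i : Fin s) : (q : ℕ) ^ (i : ℕ) ≤ (q : ℕ) ^ s :=
    Nat.pow_le_pow_right q.2.pos i.2.le
  simp only [card_spanningPoints, coeff_smul_apply, map_prod, map_sub, map_pow, coeffEval_qCoeff,
    q.card_Fq, Nat.cast_mul, Nat.cast_prod, Nat.cast_sub (hpow _), Nat.cast_pow]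

theorem spanDimSum_single_mem_GraphsStar (G : SimpleGraph V) {s r : ℕ} (hr : r ≤ s) :
    spanDimSum G s (Pi.single r 1) ∈ GraphsStar := by
  induction hr using Nat.decreasingInduction generalizing V with
  | self =>
    have := Fintype.ofFinite V
    rw [spanDimSum_single_self]
    exact Submodule.smul_mem _ _ (symRankSum_single_mem_GraphsStar G s)
  | of_succ r hr ih =>
    rw [← Submodule.smul_mem_iff_of_isUnit _ (isUnit_qCoeff_pow_sub_pow hr.ne),
      eq_sub_of_add_eq' (spanDimSum_single_addIsolated G s r).symm]
    exact sub_mem (ih _) (Submodule.smul_mem _ _ (ih G))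

theorem spanDimSum_mem_GraphsStar (G : SimpleGraph V) (s : ℕ) (g : ℕ → CoeffRing) :
    spanDimSum G s g ∈ GraphsStar := by
  have hg : spanDimSum G s g =
      spanDimSum G s (∑ r ∈ Finset.range (s + 1), g r • Pi.single r 1) := by
    refine weightedCount_congr fun q x => ?_
    have hle := (Submodule.span q.Fq (Set.range x.1.2)).finrank_le
    rw [finrank_fin_fun] at hle
    simp [Finset.sum_apply, Pi.single_apply, Nat.lt_succ_iff.mpr hle]
  simp only [hg, map_sum, map_smul]
  exact sum_mem fun r hr => Submodule.smul_mem _ _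
    (spanDimSum_single_mem_GraphsStar G (Finset.mem_range_succ_iff.mp hr))

end SpanDimension

section RankFunction

variable {V ι : Type*}

/-- The weight `ρ ↦ q ^ (s - ρ H)`, which counts the vectors orthogonal to `f(H)`. -/
def corankWeight (s : ℕ) (H : Set V) (ρ : Set V → ℕ) : CoeffRing := qCoeff ^ (s - ρ H)

theorem exists_rank_indicator_mem_adjoin (s : ℕ) (H : Set V) (r : ℕ) :
    ∃ g ∈ Algebra.adjoin CoeffRing (Set.range (corankWeight (V := V) s)),
      ∀ ρ : Set V → ℕ, ρ H ≤ s → g ρ = if ρ H = r then 1 else 0 := by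
  obtain ⟨P, hP⟩ := exists_eval_eq_ite (s := Finset.range (s + 1)) (x := fun t => qCoeff ^ (s - t))
    (fun t ht t' ht' htt' => isUnit_qCoeff_pow_sub_pow (by
      simp only [Finset.coe_range, Set.mem_Iio] at ht ht'
      lia)) r
  refine ⟨aeval (corankWeight s H) P, ?_, fun ρ hρ => ?_⟩
  · exact Algebra.adjoin_mono (Set.singleton_subset_iff.mpr (Set.mem_range_self H))
      (aeval_mem_adjoin_singleton _ _)
  · rw [aeval_fn_apply, coe_aeval_eq_eval]
    exact hP _ (Finset.mem_range_succ_iff.mpr hρ)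

/-- The graph `G` together with, for every `i`, a new vertex joined to all vertices in `N i`. -/
def attach (G : SimpleGraph V) (N : ι → Set V) : SimpleGraph (V ⊕ ι) where
  Adj
    | .inl v, .inl w => G.Adj v w
    | .inl v, .inr i | .inr i, .inl v => v ∈ N i
    | .inr _, .inr _ => False
  symm := ⟨by rintro (v | i) (w | j) h; exacts [h.symm, h, h, h]⟩
  loopless := ⟨by rintro (v | i) h; exacts [G.irrefl h, h]⟩

theorem mem_orthogonal_span_iff {R M : Type*} [CommRing R] [AddCommGroup M] [Module R M]
    {B : LinearMap.BilinForm R M} {S : Set M} {y : M} :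
    y ∈ B.orthogonal (Submodule.span R S) ↔ ∀ x ∈ S, B x y = 0 :=
  Submodule.span_le (p := LinearMap.ker (B.flip y))

/-- The new vertex `i` is sent to a vector orthogonal to `f(N i)`. -/
def attachEquiv (K : Type*) [Field K] (G : SimpleGraph V) (N : ι → Set V) (s : ℕ) :
    (Σ x : JPoints K G s, ∀ i, x.1.1.orthogonal (Submodule.span K (x.1.2 '' N i))) ≃
      JPoints K (attach G N) s where
  toFun x := ⟨(x.1.1.1, Sum.elim x.1.1.2 fun i => x.2 i), by
    refine ⟨x.1.2.1, x.1.2.2.1, ?_⟩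
    have horth (v : V) (i : ι) (hv : v ∈ N i) : x.1.1.1 (x.1.1.2 v) (x.2 i) = 0 :=
      mem_orthogonal_span_iff.mp (x.2 i).2 _ ⟨v, hv, rfl⟩
    rintro (v | i) (w | j) h
    exacts [x.1.2.2.2 v w h, horth v j h, (x.1.2.1.eq _ _).trans (horth w i h), h.elim]⟩
  invFun x := ⟨⟨(x.1.1, x.1.2 ∘ Sum.inl), x.2.1, x.2.2.1, fun v w h => x.2.2.2 (.inl v) (.inl w) h⟩,
    fun i => ⟨x.1.2 (.inr i), mem_orthogonal_span_iff.mpr <| by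
      rintro _ ⟨v, hv, rfl⟩
      exact x.2.2.2 (.inl v) (.inr i) hv⟩⟩
  left_inv _ := rfl
  right_inv x := Subtype.ext <| Prod.ext rfl <| Sum.elim_comp_inl_inr x.1.2

variable [Finite V]

/-- The sums `∑ g (ρ_f)` over the points `(Q, f)` of `J_G(s)`, where `ρ_f` is the rank function
`H ↦ dim ⟨f(H)⟩`. -/
def rankFunSum (G : SimpleGraph V) (s : ℕ) : ((Set V → ℕ) → CoeffRing) →ₗ[CoeffRing] CountFun :=
  weightedCount (S := fun q => JPoints q.Fq G s) fun q x H =>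
    finrank q.Fq (Submodule.span q.Fq (x.1.2 '' H))

theorem rankFunSum_prod_qCoeff_pow [Fintype ι] (G : SimpleGraph V) (N : ι → Set V) (s : ℕ) :
    rankFunSum G s (fun ρ => ∏ i, qCoeff ^ (s - ρ (N i))) = spanDimSum (attach G N) s 1 := by
  classical
  ext q
  have := Fintype.ofFinite (JPoints q.Fq G s)
  have := Fintype.ofFinite (JPoints q.Fq (attach G N) s)
  rw [rankFunSum, spanDimSum, weightedCount_apply, weightedCount_apply]
  have horth (x : JPoints q.Fq G s) (i : ι) :
      Nat.card (x.1.1.orthogonal (Submodule.span q.Fq (x.1.2 '' N i))) =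
        (q : ℕ) ^ (s - finrank q.Fq (Submodule.span q.Fq (x.1.2 '' N i))) := by
    rw [natCard_eq_pow_finrank (K := q.Fq), q.card_Fq,
      LinearMap.BilinForm.finrank_orthogonal x.2.2.1, finrank_fin_fun]
  have hcard : Fintype.card (JPoints q.Fq (attach G N) s) = ∑ x : JPoints q.Fq G s,
      ∏ i, (q : ℕ) ^ (s - finrank q.Fq (Submodule.span q.Fq (x.1.2 '' N i))) := by
    simp only [← Nat.card_eq_fintype_card, ← Nat.card_congr (attachEquiv q.Fq G N s),
      Nat.card_sigma, Nat.card_pi, horth]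
  simp [coeffEval_qCoeff, hcard]

theorem rankFunSum_mem_GraphsStar_of_mem_adjoin (G : SimpleGraph V) (s : ℕ)
    {g : (Set V → ℕ) → CoeffRing}
    (hg : g ∈ Algebra.adjoin CoeffRing (Set.range (corankWeight s))) :
    rankFunSum G s g ∈ GraphsStar := by
  have hmonomial : ∀ g ∈ Submonoid.closure (Set.range (corankWeight s)),
      rankFunSum G s g ∈ GraphsStar := by
    intro g hg
    obtain ⟨l, hl, rfl⟩ := Submonoid.exists_list_of_mem_closure hg
    choose N hN using fun i : Fin l.length => hl l[i] (l.getElem_mem i.2)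
    have hprod : l.prod = fun ρ => ∏ i, qCoeff ^ (s - ρ (N i)) := by
      ext ρ
      rw [← Fin.prod_univ_getElem, Finset.prod_apply]
      exact Finset.prod_congr rfl fun i _ => congrFun (hN i).symm ρ
    rw [hprod, rankFunSum_prod_qCoeff_pow]
    exact spanDimSum_mem_GraphsStar _ _ _
  rw [← Subalgebra.mem_toSubmodule, Algebra.adjoin_eq_span] at hg
  exact Submodule.span_le (p := GraphsStar.comap (rankFunSum G s)).mpr hmonomial hg

open scoped Classical in
theorem countJ_eq_rankFunSum (G : SimpleGraph V) (s : ℕ) {U : Set (Set V)} (π : U → ℕ) :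
    countJ G s π = rankFunSum G s fun ρ => if ∀ H : U, ρ H = π H then 1 else 0 := by
  rw [rankFunSum, weightedCount_ite _ fun ρ : Set V → ℕ => ∀ H : U, ρ H = π H]
  refine funext fun q => congrArg Nat.cast (Nat.card_congr ?_)
  exact (Equiv.subtypeSubtypeEquivSubtypeInter (· ∈ JPoints q.Fq G s) fun x =>
    ∀ H : U, finrank q.Fq (Submodule.span q.Fq (x.2 '' H)) = π H).symm

theorem rankFunSum_congr {G : SimpleGraph V} {s : ℕ} {g h : (Set V → ℕ) → CoeffRing}
    (hgh : ∀ ρ, (∀ H, ρ H ≤ s) → g ρ = h ρ) : rankFunSum G s g = rankFunSum G s h :=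
  weightedCount_congr fun _ _ => hgh _ fun _ =>
    (Submodule.finrank_le _).trans_eq (finrank_fin_fun _)

end RankFunction

end GraphMotives

end

theorem mainTheorem7 {V : Type*} [Finite V] (G : SimpleGraph V) (s : ℕ)
    (U : Set (Set V)) (π : U → ℕ) :
    GraphMotives.countJ G s π ∈ GraphMotives.GraphsStar := by
  classical
  have := Fintype.ofFinite U
  choose g hg hgite using fun H : U => GraphMotives.exists_rank_indicator_mem_adjoin s H.1 (π H)
  have hcount : GraphMotives.countJ G s π = GraphMotives.rankFunSum G s (∏ H, g H) := by
    rw [GraphMotives.countJ_eq_rankFunSum]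
    refine GraphMotives.rankFunSum_congr fun ρ hρ => ?_
    rw [Finset.prod_apply, Finset.prod_congr rfl fun H _ => hgite H ρ (hρ H)]
    simp [Finset.prod_ite_zero]
  rw [hcount]
  exact GraphMotives.rankFunSum_mem_GraphsStar_of_mem_adjoin G s (prod_mem fun H _ => hg H)
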